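/- **Setting.** For a poset $P$, a set is Scott open if it is an upper set that meets every nonempty directed set whose supremum exists and belongs to it; $\Sigma P$ is $P$ with this (Scott) topology, and topological notions for posets refer to it. A topological space is *well-filtered* if, for every open set $U$ and every filter basis $\mathcal C$ of compact saturated sets with $\bigcap\mathcal C\subseteq U$, some $K\in\mathcal C$ satisfies $K\subseteq U$ (a set is saturated if it is an intersection of open sets). Let $\mathbf{WF}$ be the category of dcpos $L$ such that $\Sigma L$ is well-filtered, with Scott-continuous maps as morphisms. * The Hoare power monad $(\mathcal H,\eta,\mu)$ on $\mathbf{WF}$: $\mathcal H(L)$ is the set of all Scott closed subsets of $L$ (including $\emptyset$) ordered by inclusion, $\mathcal H(f)(A)=\mathrm{cl}(f(A))$, $\eta_L(x)={\downarrow}x$, $\mu_L(\mathcal A)=\bigcup\mathcal A$. * The Smyth power monad $(\mathcal Q,\theta,\iota)$ on $\mathbf{WF}$: $\mathcal Q(L)$ is the set of all nonempty compact saturated subsets of $\Sigma L$ ordered by reverse inclusion, $\mathcal Q(f)(K)={\uparrow}f(K)$, $\theta_L(x)={\uparrow}x$, $\iota_L(\mathcal K)=\bigcup\mathcal K$. *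 The distributive law $\phi_L:\mathcal H(\mathcal Q(L))\to\mathcal Q(\mathcal H(L))$, $\phi_L(\mathcal A)=\{A\in\mathcal H(L): A\cap K\neq\emptyset\text{ for all }K\in\mathcal A\}$. * The composite monad $\mathcal{QH}$ determined by $\phi$: the functor is $\mathcal Q\circ\mathcal H$, the unit is $\gamma_L=\theta_{\mathcal H(L)}\circ\eta_L$, and the multiplication is $\rho_L=\mathcal Q\mu_L\circ\iota_{\mathcal H\mathcal H(L)}\circ\mathcal Q\phi_{\mathcal H(L)}$. For a monad $(\mathcal T,\eta,\mu)$, a morphism $\alpha:\mathcal T(C)\to C$ is a *structure map* of $C$, and $(C,\alpha)$ a $\mathcal T$-algebra, if $\alpha\circ\eta_C=\mathrm{id}_C$ and $\alpha\circ\mu_C=\alpha\circ\mathcal T\alpha$; a homomorphism $h:(A,\alpha_A)\to(B,\alpha_B)$ of $\mathcal T$-algebras is a morphism $h:A\to B$ with $h\circ\alpha_A=\alpha_B\circ\mathcal T h$. **Proposition.** Let $(L,\alpha)$ be a $\mathcal{QH}$-algebra in $\mathbf{WF}$. Then: 1. $L$ is a $\mathcal Q$-algebra with structure map $\alpha^{\mathcal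 Q}=\alpha\circ\mathcal Q\eta_L$, and an $\mathcal H$-algebra with structure map $\alpha^{\mathcal H}=\alpha\circ\theta_{\mathcal H(L)}$. 2. $\alpha:(\mathcal{QH}(L),\iota_{\mathcal H(L)})\to(L,\alpha^{\mathcal Q})$ is a $\mathcal Q$-algebra homomorphism, and $\alpha\circ\phi_L:(\mathcal{HQ}(L),\mu_{\mathcal Q(L)})\to(L,\alpha^{\mathcal H})$ is an $\mathcal H$-algebra homomorphism. 3. $\alpha$ is the unique $\mathcal{QH}$-structure map of $L$: if $\beta:\mathcal{QH}(L)\to L$ is a $\mathcal{QH}$-structure map of $L$, then $\beta=\alpha$. -/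

import Mathlib

open CategoryTheory Set

universe u v

namespace PowerWF

/-! ### Saturated sets, well-filtered spaces, dcpos -/

/-- A subset of a space is saturated if it is an intersection of open sets. -/
def IsSaturated {X : Type u} [TopologicalSpace X] (s : Set X) : Prop :=
  ∃ 𝒰 : Set (Set X), (∀ U ∈ 𝒰, IsOpen U) ∧ s = ⋂₀ 𝒰

/-- A space is well-filtered if, whenever the intersection of a filter basis of compact saturated
sets lies in an open set `U`, some member of the filter basis lies in `U`. -/
def WellFiltered (X : Type u) [TopologicalSpace X] : Prop :=
  ∀ (𝒞 : Set (Set X)) (U : Set X), 𝒞.Nonempty → DirectedOn (· ⊇ ·) 𝒞 →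
    (∀ K ∈ 𝒞, IsCompact K ∧ IsSaturated K) → IsOpen U → ⋂₀ 𝒞 ⊆ U → ∃ K ∈ 𝒞, K ⊆ U

/-- A dcpo is a poset in which every nonempty directed subset has a supremum. -/
def IsDcpo (P : Type u) [PartialOrder P] : Prop :=
  ∀ d : Set P, d.Nonempty → DirectedOn (· ≤ ·) d → ∃ a, IsLUB d a

/-! ### The category of well-filtered dcpos and Scott-continuous maps -/

/-- A well-filtered dcpo: a dcpo whose Scott topology is well-filtered. -/
structure WF where
  carrier : Type u
  [order : PartialOrder carrier]
  dcpo : IsDcpo carrier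
  wellFiltered : @WellFiltered carrier (Topology.scott carrier univ)

namespace WF

instance : CoeSort WF.{u} (Type u) := ⟨WF.carrier⟩

instance (L : WF.{u}) : PartialOrder L := L.order

/-- A well-filtered dcpo always carries its Scott topology. -/
instance (L : WF.{u}) : TopologicalSpace L := Topology.scott L univ

instance (L : WF.{u}) : Topology.IsScott L univ := ⟨rfl⟩

/-- Morphisms: maps that are continuous for the Scott topologies. -/
@[ext]
structure Hom (L M : WF.{u}) where
  toFun : L → M
  continuous_toFun : Continuous toFun

instance : Category WF.{u} where
  Hom L M := Hom L M
  id L := ⟨fun x => x, continuous_id⟩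
  comp f g := ⟨fun x => g.toFun (f.toFun x), g.continuous_toFun.comp f.continuous_toFun⟩

theorem hom_ext {L M : WF.{u}} {f g : L ⟶ M} (h : ∀ x, f.toFun x = g.toFun x) : f = g :=
  Hom.ext (funext h)

end WF

/-! ### Facts on Scott topologies -/

section Scott

variable {X : Type u} [PartialOrder X] [TopologicalSpace X] [Topology.IsScott X univ]
variable {Y : Type v} [PartialOrder Y] [TopologicalSpace Y] [Topology.IsScott Y univ]

theorem isSaturated_iff {s : Set X} : IsSaturated s ↔ IsUpperSet s := by
  constructor
  · rintro ⟨𝒰, h, rfl⟩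
    exact isUpperSet_sInter fun U hU =>
      Topology.IsScott.isUpperSet_of_isOpen (D := univ) (h U hU)
  · intro h
    refine ⟨{U | ∃ x, x ∉ s ∧ U = (Iic x)ᶜ}, ?_, ?_⟩
    · rintro U ⟨x, -, rfl⟩
      exact isClosed_Iic.isOpen_compl
    · ext y
      simp only [mem_sInter, mem_ofPred_eq]
      constructor
      · rintro hy U ⟨x, hx, rfl⟩ hyx
        exact hx (h hyx hy)
      · intro hy
        by_contra hys
        exact hy _ ⟨y, hys, rfl⟩ le_rfl

theorem monotone_of_continuous {f : X → Y} (hf : Continuous f) : Monotone f :=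
  Topology.IsScott.monotone_of_continuous (D := univ) hf

theorem continuous_of_isLUB {f : X → Y}
    (h : ∀ d : Set X, d.Nonempty → DirectedOn (· ≤ ·) d → ∀ a, IsLUB d a → IsLUB (f '' d) (f a)) :
    Continuous f := by
  rw [← Topology.IsScott.scottContinuousOn_iff_continuous (D := univ) (fun _ _ _ => mem_univ _),
    scottContinuousOn_univ]
  exact fun d h1 h2 a h3 => h d h1 h2 a h3

theorem isLUB_of_continuous {f : X → Y} (hf : Continuous f) {d : Set X} (h1 : d.Nonempty)
    (h2 : DirectedOn (· ≤ ·) d) {a : X} (h3 : IsLUB d a) : IsLUB (f '' d) (f a) := by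
  rw [← Topology.IsScott.scottContinuousOn_iff_continuous (D := univ) (fun _ _ _ => mem_univ _),
    scottContinuousOn_univ] at hf
  exact hf h1 h2 h3

theorem compact_inter_directed {Z : Type u} [TopologicalSpace Z] {K : Set Z} (hK : IsCompact K)
    {ι : Type v} [Nonempty ι] (t : ι → Set Z) (ht : ∀ i, IsClosed (t i)) (hd : Directed (· ⊇ ·) t)
    (h : ∀ i, (K ∩ t i).Nonempty) : (K ∩ ⋂ i, t i).Nonempty := by
  by_contra hne
  rw [not_nonempty_iff_eq_empty] at hne
  obtain ⟨i, hi⟩ := hK.elim_directed_family_closed t ht hne hd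
  exact (h i).ne_empty hi

theorem isCompact_of_directed {Z : Type u} [TopologicalSpace Z] {K : Set Z}
    (h : ∀ F : Set (Set Z), F.Nonempty → DirectedOn (· ⊇ ·) F → (∀ A ∈ F, IsClosed A) →
      (∀ A ∈ F, (K ∩ A).Nonempty) → (K ∩ ⋂₀ F).Nonempty) : IsCompact K := by
  classical
  refine isCompact_of_finite_subfamily_closed fun {ι} t ht hK => ?_
  by_contra! hcon
  have := h (range fun u : Finset ι => ⋂ i ∈ u, t i) (range_nonempty _) ?_ ?_ ?_
  · obtain ⟨x, hxK, hx⟩ := this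
    have hx2 : x ∈ K ∩ ⋂ i, t i := ⟨hxK, mem_iInter.2 fun i => by
      simpa using hx _ ⟨{i}, rfl⟩⟩
    rw [hK] at hx2
    exact hx2
  · rintro _ ⟨a, rfl⟩ _ ⟨b, rfl⟩
    exact ⟨_, ⟨a ∪ b, rfl⟩, biInter_subset_biInter_left fun i hi => Finset.mem_union_left b hi,
      biInter_subset_biInter_left fun i hi => Finset.mem_union_right a hi⟩
  · rintro _ ⟨a, rfl⟩
    exact isClosed_biInter fun i _ => ht i
  · rintro _ ⟨a, rfl⟩
    exact hcon a

/-- Every closed set meeting all members of a family of compact sets contains a minimal one. -/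
theorem exists_minimal_closed {Z : Type u} [TopologicalSpace Z] {𝒞 : Set (Set Z)}
    (h𝒞 : ∀ K ∈ 𝒞, IsCompact K) {A : Set Z} (hA : IsClosed A) (h : ∀ K ∈ 𝒞, (K ∩ A).Nonempty) :
    ∃ B ⊆ A, IsClosed B ∧ (∀ K ∈ 𝒞, (K ∩ B).Nonempty) ∧
      ∀ C ⊆ B, IsClosed C → (∀ K ∈ 𝒞, (K ∩ C).Nonempty) → B ⊆ C := by
  obtain ⟨B, hBA, hB⟩ := zorn_superset_nonempty
    {B : Set Z | IsClosed B ∧ ∀ K ∈ 𝒞, (K ∩ B).Nonempty} (fun c hc hch hne => by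
      refine ⟨⋂₀ c, ⟨isClosed_sInter fun s hs => (hc hs).1, fun K hK => ?_⟩,
        fun s hs => sInter_subset_of_mem hs⟩
      have : Nonempty c := hne.to_subtype
      rw [sInter_eq_iInter]
      refine compact_inter_directed (h𝒞 K hK) _ (fun i => (hc i.2).1) ?_ fun i => (hc i.2).2 K hK
      intro a b
      rcases hch.total a.2 b.2 with hab | hab
      · exact ⟨a, Subset.rfl, hab⟩
      · exact ⟨b, hab, Subset.rfl⟩) A ⟨hA, h⟩
  exact ⟨B, hBA, hB.prop.1, hB.prop.2, fun C hC h1 h2 => hB.le_of_le ⟨h1, h2⟩ hC⟩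

end Scott

section Semilattice

variable {X : Type u} [SemilatticeSup X] [TopologicalSpace X] [Topology.IsScott X univ]

theorem isClosed_sup_mem {A : Set X} (hA : IsClosed A) (e : X) : IsClosed {x | e ⊔ x ∈ A} := by
  have hA2 := Topology.IsScott.isClosed_iff_isLowerSet_and_dirSupClosed.1 hA
  refine Topology.IsScott.isClosed_iff_isLowerSet_and_dirSupClosed.2 ⟨?_, ?_⟩
  · intro x y hyx hx
    exact hA2.1 (sup_le_sup_left hyx e) hx
  · intro d hd hne hdir a ha
    refine hA2.2 (d := (fun x => e ⊔ x) '' d) ?_ (hne.image _) ?_ ?_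
    · rintro _ ⟨x, hx, rfl⟩
      exact hd hx
    · rintro _ ⟨x, hx, rfl⟩ _ ⟨y, hy, rfl⟩
      obtain ⟨z, hz, hxz, hyz⟩ := hdir x hx y hy
      exact ⟨_, ⟨z, hz, rfl⟩, sup_le_sup_left hxz e, sup_le_sup_left hyz e⟩
    · constructor
      · rintro _ ⟨x, hx, rfl⟩
        exact sup_le_sup_left (ha.1 hx) e
      · intro b hb
        obtain ⟨x, hx⟩ := hne
        refine sup_le (le_sup_left.trans (hb ⟨x, hx, rfl⟩)) (ha.2 fun y hy => ?_)
        exact le_sup_right.trans (hb ⟨y, hy, rfl⟩)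

theorem isClosed_lower_inter {A K : Set X} (hA : IsClosed A) (hK : IsCompact K)
    (hKu : IsUpperSet K) : IsClosed {y | ∃ k ∈ K ∩ A, y ≤ k} := by
  refine Topology.IsScott.isClosed_iff_isLowerSet_and_dirSupClosed.2 ⟨?_, ?_⟩
  · rintro x y hyx ⟨k, hk, hxk⟩
    exact ⟨k, hk, hyx.trans hxk⟩
  · intro d hd hne hdir a ha
    have : Nonempty d := hne.to_subtype
    have hAl := Topology.IsScott.isLowerSet_of_isClosed hA
    obtain ⟨x, hxK, hx⟩ := compact_inter_directed hK (fun e : d => {x | (e : X) ⊔ x ∈ A})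
      (fun e => isClosed_sup_mem hA _)
      (by
        intro e f
        obtain ⟨g, hg, heg, hfg⟩ := hdir e e.2 f f.2
        exact ⟨⟨g, hg⟩, fun x hx => hAl (sup_le_sup_right heg x) hx,
          fun x hx => hAl (sup_le_sup_right hfg x) hx⟩)
      (by
        intro e
        obtain ⟨k, hk, hek⟩ := hd e.2
        refine ⟨k, hk.1, ?_⟩
        change (e : X) ⊔ k ∈ A
        rw [sup_eq_right.2 hek]
        exact hk.2)
    refine ⟨a ⊔ x, ⟨hKu le_sup_right hxK, ?_⟩, le_sup_left⟩
    have hcl := Topology.IsScott.isClosed_iff_isLowerSet_and_dirSupClosed.1 (isClosed_sup_mem hA x)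
    have : a ∈ {y | x ⊔ y ∈ A} := by
      refine hcl.2 (fun e he => ?_) hne hdir ha
      have := mem_iInter.1 hx ⟨e, he⟩
      change x ⊔ e ∈ A
      rw [sup_comm]
      exact this
    rw [sup_comm]
    exact this

theorem isCompact_inter_of_upper {K M : Set X} (hK : IsCompact K) (hKu : IsUpperSet K)
    (hM : IsCompact M) (hMu : IsUpperSet M) : IsCompact (K ∩ M) := by
  refine isCompact_of_directed fun F hne hdir hF hmeet => ?_
  have : Nonempty F := hne.to_subtype
  obtain ⟨x, hxM, hx⟩ := compact_inter_directed hM (fun A : F => {y | ∃ k ∈ K ∩ (A : Set X), y ≤ k})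
    (fun A => isClosed_lower_inter (hF A A.2) hK hKu)
    (by
      intro A B
      obtain ⟨C, hC, hCA, hCB⟩ := hdir A A.2 B B.2
      exact ⟨⟨C, hC⟩, fun x ⟨k, hk, hxk⟩ => ⟨k, ⟨hk.1, hCA hk.2⟩, hxk⟩,
        fun x ⟨k, hk, hxk⟩ => ⟨k, ⟨hk.1, hCB hk.2⟩, hxk⟩⟩)
    (by
      intro A
      obtain ⟨k, hk, hkA⟩ := hmeet A A.2
      exact ⟨k, hk.2, k, ⟨hk.1, hkA⟩, le_rfl⟩)
  obtain ⟨y, hyK, hy⟩ := compact_inter_directed hK (fun A : F => {y | x ⊔ y ∈ (A : Set X)})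
    (fun A => isClosed_sup_mem (hF A A.2) x)
    (by
      intro A B
      obtain ⟨C, hC, hCA, hCB⟩ := hdir A A.2 B B.2
      exact ⟨⟨C, hC⟩, fun x hx => hCA hx, fun x hx => hCB hx⟩)
    (by
      intro A
      obtain ⟨k, hk, hxk⟩ := mem_iInter.1 hx A
      refine ⟨k, hk.1, ?_⟩
      change x ⊔ k ∈ (A : Set X)
      rw [sup_eq_right.2 hxk]
      exact hk.2)
  refine ⟨x ⊔ y, ⟨hKu le_sup_right hyK, hMu le_sup_left hxM⟩, fun A hA => ?_⟩
  exact mem_iInter.1 hy ⟨A, hA⟩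

theorem wellFiltered_of_sup (hX : IsDcpo X) : WellFiltered X := by
  intro 𝒞 U hne hdir h𝒞 hU hsub
  by_contra! hcon
  have hne1 : ∀ K ∈ 𝒞, (K ∩ Uᶜ).Nonempty := fun K hK => by
    obtain ⟨x, hx, hxU⟩ := not_subset.1 (hcon K hK)
    exact ⟨x, hx, hxU⟩
  obtain ⟨A, hAU, hA, hA𝒞, hmin⟩ :=
    exists_minimal_closed (fun K hK => (h𝒞 K hK).1) hU.isClosed_compl hne1
  have hA2 := Topology.IsScott.isClosed_iff_isLowerSet_and_dirSupClosed.1 hA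
  have hkey : ∀ K ∈ 𝒞, ∀ a ∈ A, ∃ k ∈ K ∩ A, a ≤ k := by
    intro K hK
    refine hmin {y | ∃ k ∈ K ∩ A, y ≤ k} ?_ ?_ ?_
    · rintro y ⟨k, hk, hyk⟩
      exact hA2.1 hyk hk.2
    · exact isClosed_lower_inter hA (h𝒞 K hK).1 (isSaturated_iff.1 (h𝒞 K hK).2)
    · intro M hM
      obtain ⟨N, hN, hNK, hNM⟩ := hdir K hK M hM
      obtain ⟨x, hxN, hxA⟩ := hA𝒞 N hN
      exact ⟨x, hNM hxN, x, ⟨hNK hxN, hxA⟩, le_rfl⟩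
  obtain ⟨K, hK⟩ := hne
  obtain ⟨a, -, haA⟩ := hA𝒞 K hK
  obtain ⟨m, -, hm⟩ := zorn_le_nonempty₀ A (fun c hc hch y hy => by
    obtain ⟨b, hb⟩ := hX c ⟨y, hy⟩ hch.directedOn
    exact ⟨b, hA2.2 hc ⟨y, hy⟩ hch.directedOn hb, hb.1⟩) a haA
  have hmU : m ∈ U := hsub fun M hM => by
    obtain ⟨k, hk, hmk⟩ := hkey M hM m hm.prop
    rw [hm.eq_of_le hk.2 hmk]
    exact hk.1
  exact hAU hm.prop hmU

/-- In a join-semilattice that is a dcpo with least element, arbitrary intersections of compact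
saturated sets are compact. -/
theorem isCompact_sInter_of_upper [OrderBot X] (hX : IsDcpo X) {𝒞 : Set (Set X)}
    (h𝒞 : ∀ K ∈ 𝒞, IsCompact K ∧ IsUpperSet K) : IsCompact (⋂₀ 𝒞) := by
  classical
  have hfin : ∀ u : Finset (Set X), (∀ K ∈ u, K ∈ 𝒞) → IsCompact (⋂₀ (u : Set (Set X))) := by
    intro u
    induction u using Finset.induction_on with
    | empty =>
      intro _
      simp only [Finset.coe_empty, sInter_empty]
      refine isCompact_of_directed fun F hne hdir hF hmeet => ⟨⊥, mem_univ _, fun A hA => ?_⟩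
      obtain ⟨x, -, hx⟩ := hmeet A hA
      exact Topology.IsScott.isLowerSet_of_isClosed (hF A hA) bot_le hx
    | insert K u hKu ih =>
      intro h
      rw [Finset.coe_insert, sInter_insert]
      have hu : ∀ M ∈ u, M ∈ 𝒞 := fun M hM => h M (Finset.mem_insert_of_mem hM)
      have hK := h𝒞 K (h K (Finset.mem_insert_self K u))
      exact isCompact_inter_of_upper hK.1 hK.2 (ih hu)
        (isUpperSet_sInter fun M hM => (h𝒞 M (hu M hM)).2)
  refine isCompact_of_directed fun F hne hdir hF hmeet => ?_
  by_contra hcon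
  have hsub : ⋂₀ 𝒞 ⊆ (⋂₀ F)ᶜ := fun x hx hxF => hcon ⟨x, hx, hxF⟩
  obtain ⟨_, ⟨u, hu, rfl⟩, huF⟩ := wellFiltered_of_sup hX
    {K | ∃ u : Finset (Set X), (∀ K ∈ u, K ∈ 𝒞) ∧ K = ⋂₀ (u : Set (Set X))} (⋂₀ F)ᶜ
    ⟨_, ∅, by simp, rfl⟩ (by
      rintro _ ⟨a, ha, rfl⟩ _ ⟨b, hb, rfl⟩
      refine ⟨_, ⟨a ∪ b, ?_, rfl⟩, ?_, ?_⟩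
      · intro K hK
        rcases Finset.mem_union.1 hK with hK | hK
        exacts [ha K hK, hb K hK]
      · exact sInter_subset_sInter (by simp)
      · exact sInter_subset_sInter (by simp))
    (by
      rintro _ ⟨a, ha, rfl⟩
      exact ⟨hfin a ha, isSaturated_iff.2 (isUpperSet_sInter fun M hM => (h𝒞 M (ha M hM)).2)⟩)
    (isClosed_sInter hF).isOpen_compl (fun x hx => hsub fun K hK =>
      hx K ⟨{K}, by simpa using hK, by simp⟩)
  have : Nonempty F := hne.to_subtype
  obtain ⟨x, hxu, hx⟩ := compact_inter_directed (hfin u hu) (fun A : F => (A : Set X))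
    (fun A => hF A A.2) (fun A B => by
      obtain ⟨C, hC, hCA, hCB⟩ := hdir A A.2 B B.2
      exact ⟨⟨C, hC⟩, hCA, hCB⟩)
    (fun A => by
      obtain ⟨x, hx, hxA⟩ := hmeet A A.2
      exact ⟨x, fun M hM => hx M (hu M hM), hxA⟩)
  exact huF hxu (by rwa [sInter_eq_iInter])

end Semilattice

/-! ### The Hoare power construction -/

/-- The Hoare power construction: all closed subsets (including the empty one), ordered by
inclusion. -/
def Hoare (X : Type u) [TopologicalSpace X] : Type u := TopologicalSpace.Closeds X

namespace Hoare

section General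

variable {X : Type u} [TopologicalSpace X]

instance : CompleteLattice (Hoare X) := inferInstanceAs (CompleteLattice (TopologicalSpace.Closeds X))

/-- The underlying closed set. -/
def carrier (A : Hoare X) : Set X := TopologicalSpace.Closeds.carrier A

theorem isClosed (A : Hoare X) : IsClosed A.carrier := TopologicalSpace.Closeds.isClosed' A

/-- A closed set as an element of the Hoare power construction. -/
def mk (s : Set X) (hs : IsClosed s) : Hoare X := (⟨s, hs⟩ : TopologicalSpace.Closeds X)

theorem le_def {A B : Hoare X} : A ≤ B ↔ A.carrier ⊆ B.carrier := Iff.rfl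

instance : TopologicalSpace (Hoare X) := Topology.scott (Hoare X) univ

instance : Topology.IsScott (Hoare X) univ := ⟨rfl⟩

theorem isDcpo : IsDcpo (Hoare X) := fun d _ _ => ⟨sSup d, isLUB_sSup d⟩

theorem eq_of_le_iff {A B : Hoare X} (h : ∀ C, A ≤ C ↔ B ≤ C) : A = B :=
  le_antisymm ((h B).2 le_rfl) ((h A).1 le_rfl)

/-- The closure of the image under a map. -/
def map {Y : Type v} [TopologicalSpace Y] (f : X → Y) (A : Hoare X) : Hoare Y :=
  mk (closure (f '' A.carrier)) isClosed_closure

theorem map_le_iff {Y : Type v} [TopologicalSpace Y] {f : X → Y} {A : Hoare X} {B : Hoare Y} :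
    map f A ≤ B ↔ ∀ a ∈ A.carrier, f a ∈ B.carrier := by
  rw [le_def]
  exact B.isClosed.closure_subset_iff.trans image_subset_iff

theorem continuous_map {Y : Type v} [TopologicalSpace Y] {f : X → Y} (hf : Continuous f) :
    Continuous (map f) := by
  have hgc : GaloisConnection (map f)
    (fun B : Hoare Y => mk (f ⁻¹' B.carrier) (B.isClosed.preimage hf)) := fun _ _ => map_le_iff
  exact continuous_of_isLUB fun d _ _ a ha => hgc.isLUB_l_image ha

end General

section Scott

variable {X : Type u} [PartialOrder X] [TopologicalSpace X] [Topology.IsScott X univ]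

theorem isLowerSet (A : Hoare X) : IsLowerSet A.carrier :=
  Topology.IsScott.isLowerSet_of_isClosed A.isClosed

theorem dirSupClosed (A : Hoare X) : DirSupClosed A.carrier :=
  Topology.IsScott.dirSupClosed_of_isClosed A.isClosed

/-- The unit: `x ↦ ↓x`. -/
def down (x : X) : Hoare X := mk (Iic x) isClosed_Iic

theorem down_le_iff {x : X} {A : Hoare X} : down x ≤ A ↔ x ∈ A.carrier :=
  ⟨fun h => h (mem_Iic.2 le_rfl), fun h _ hy => A.isLowerSet hy h⟩

theorem isLUB_down {d : Set X} (hne : d.Nonempty) (hdir : DirectedOn (· ≤ ·) d) {a : X}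
    (ha : IsLUB d a) : IsLUB (down '' d) (down a) := by
  constructor
  · rintro _ ⟨x, hx, rfl⟩
    exact down_le_iff.2 (ha.1 hx)
  · intro B hB
    exact down_le_iff.2 (B.dirSupClosed (fun x hx => down_le_iff.1 (hB ⟨x, hx, rfl⟩)) hne hdir ha)

theorem continuous_down : Continuous (down : X → Hoare X) :=
  continuous_of_isLUB fun _ h1 h2 _ h3 => isLUB_down h1 h2 h3

/-- The multiplication: `𝒜 ↦ ⋃ 𝒜`. -/
def join (𝒜 : Hoare (Hoare X)) : Hoare X :=
  mk {x | ∃ A ∈ 𝒜.carrier, x ∈ A.carrier} (by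
    refine Topology.IsScott.isClosed_iff_isLowerSet_and_dirSupClosed.2 ⟨?_, ?_⟩
    · rintro x y hyx ⟨A, hA, hx⟩
      exact ⟨A, hA, A.isLowerSet hyx hx⟩
    · intro d hd hne hdir a ha
      refine ⟨down a, 𝒜.dirSupClosed (d := down '' d) ?_ (hne.image _) ?_
        (isLUB_down hne hdir ha), mem_Iic.2 le_rfl⟩
      · rintro _ ⟨x, hx, rfl⟩
        obtain ⟨A, hA, hxA⟩ := hd hx
        exact 𝒜.isLowerSet (down_le_iff.2 hxA) hA
      · rintro _ ⟨x, hx, rfl⟩ _ ⟨y, hy, rfl⟩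
        obtain ⟨z, hz, hxz, hyz⟩ := hdir x hx y hy
        exact ⟨_, ⟨z, hz, rfl⟩, down_le_iff.2 hxz, down_le_iff.2 hyz⟩)

theorem join_le_iff {𝒜 : Hoare (Hoare X)} {B : Hoare X} :
    join 𝒜 ≤ B ↔ ∀ A ∈ 𝒜.carrier, A ≤ B :=
  ⟨fun h A hA _ hx => h ⟨A, hA, hx⟩, fun h _ ⟨A, hA, hx⟩ => h A hA hx⟩

theorem continuous_join : Continuous (join : Hoare (Hoare X) → Hoare X) := by
  have hgc : GaloisConnection (join : Hoare (Hoare X) → Hoare X) down := fun _ _ => join_le_iff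
  exact continuous_of_isLUB fun d _ _ a ha => hgc.isLUB_l_image ha

end Scott

end Hoare

/-! ### The Smyth power construction -/

/-- The Smyth power construction: all nonempty compact saturated subsets. -/
@[ext]
structure Smyth (X : Type u) [TopologicalSpace X] where
  carrier : Set X
  nonempty : carrier.Nonempty
  isCompact : IsCompact carrier
  isSaturated : IsSaturated carrier

namespace Smyth

section General

variable {X : Type u} [TopologicalSpace X]

/-- The order is reverse inclusion. -/
instance : PartialOrder (Smyth X) where
  le K M := M.carrier ⊆ K.carrier
  le_refl _ := Subset.rfl
  le_trans _ _ _ h1 h2 := h2.trans h1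
  le_antisymm _ _ h1 h2 := Smyth.ext (h2.antisymm h1)

theorem le_def {K M : Smyth X} : K ≤ M ↔ M.carrier ⊆ K.carrier := Iff.rfl

instance : TopologicalSpace (Smyth X) := Topology.scott (Smyth X) univ

instance : Topology.IsScott (Smyth X) univ := ⟨rfl⟩

end General

section Scott

variable {X : Type u} [PartialOrder X] [TopologicalSpace X] [Topology.IsScott X univ]

theorem isUpperSet (K : Smyth X) : IsUpperSet K.carrier := isSaturated_iff.1 K.isSaturated

/-- The intersection of a directed family. -/
def inter (hX : WellFiltered X) (d : Set (Smyth X)) (hne : d.Nonempty)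
    (hdir : DirectedOn (· ≤ ·) d) : Smyth X where
  carrier := {x | ∀ K ∈ d, x ∈ K.carrier}
  nonempty := by
    by_contra hcon
    obtain ⟨_, ⟨K, hK, rfl⟩, h⟩ := hX (carrier '' d) ∅ (hne.image _) (by
      rintro _ ⟨K, hK, rfl⟩ _ ⟨M, hM, rfl⟩
      obtain ⟨N, hN, h1, h2⟩ := hdir K hK M hM
      exact ⟨_, ⟨N, hN, rfl⟩, h1, h2⟩) (by
      rintro _ ⟨K, hK, rfl⟩
      exact ⟨K.isCompact, K.isSaturated⟩) isOpen_empty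
      (fun x hx => hcon ⟨x, fun K hK => hx _ ⟨K, hK, rfl⟩⟩)
    exact K.nonempty.ne_empty (subset_empty_iff.1 h)
  isCompact := by
    refine isCompact_of_directed fun F hFne hFdir hF hmeet => ?_
    by_contra hcon
    obtain ⟨_, ⟨K, hK, rfl⟩, h⟩ := hX (carrier '' d) (⋂₀ F)ᶜ (hne.image _) (by
      rintro _ ⟨K, hK, rfl⟩ _ ⟨M, hM, rfl⟩
      obtain ⟨N, hN, h1, h2⟩ := hdir K hK M hM
      exact ⟨_, ⟨N, hN, rfl⟩, h1, h2⟩) (by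
      rintro _ ⟨K, hK, rfl⟩
      exact ⟨K.isCompact, K.isSaturated⟩) (isClosed_sInter hF).isOpen_compl
      (fun x hx hxF => hcon ⟨x, fun K hK => hx _ ⟨K, hK, rfl⟩, hxF⟩)
    have : Nonempty F := hFne.to_subtype
    obtain ⟨x, hxu, hx⟩ := compact_inter_directed K.isCompact (fun A : F => (A : Set X))
      (fun A => hF A A.2) (fun A B => by
        obtain ⟨C, hC, hCA, hCB⟩ := hFdir A A.2 B B.2
        exact ⟨⟨C, hC⟩, hCA, hCB⟩)
      (fun A => by
        obtain ⟨x, hx, hxA⟩ := hmeet A A.2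
        exact ⟨x, hx K hK, hxA⟩)
    exact h hxu (by rwa [sInter_eq_iInter])
  isSaturated := isSaturated_iff.2 fun _ _ hxy hx K hK => K.isUpperSet hxy (hx K hK)

theorem isLUB_inter (hX : WellFiltered X) (d : Set (Smyth X)) (hne : d.Nonempty)
    (hdir : DirectedOn (· ≤ ·) d) : IsLUB d (inter hX d hne hdir) :=
  ⟨fun K hK _ hx => hx K hK, fun _ hM _ hx _ hK => hM hK hx⟩

theorem isDcpo (hX : WellFiltered X) : IsDcpo (Smyth X) :=
  fun d hne hdir => ⟨_, isLUB_inter hX d hne hdir⟩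

/-- For `U` open, the sets contained in `U` form a Scott open set. -/
theorem isOpen_box (hX : WellFiltered X) {U : Set X} (hU : IsOpen U) :
    IsOpen {K : Smyth X | K.carrier ⊆ U} := by
  rw [Topology.IsScott.isOpen_iff_isUpperSet_and_dirSupInaccOn (D := univ), dirSupInaccOn_univ]
  refine ⟨fun _ _ hKM hK => Subset.trans hKM hK, fun d hne hdir a ha haU => ?_⟩
  rw [ha.unique (isLUB_inter hX d hne hdir)] at haU
  obtain ⟨_, ⟨K, hK, rfl⟩, h⟩ := hX (carrier '' d) U (hne.image _) (by
    rintro _ ⟨K, hK, rfl⟩ _ ⟨M, hM, rfl⟩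
    obtain ⟨N, hN, h1, h2⟩ := hdir K hK M hM
    exact ⟨_, ⟨N, hN, rfl⟩, h1, h2⟩) (by
    rintro _ ⟨K, hK, rfl⟩
    exact ⟨K.isCompact, K.isSaturated⟩) hU
    (fun x hx => haU fun K hK => hx _ ⟨K, hK, rfl⟩)
  exact ⟨K, hK, h⟩

theorem exists_subset_of_isLUB (hX : WellFiltered X) {U : Set X} (hU : IsOpen U)
    {d : Set (Smyth X)} (hne : d.Nonempty) (hdir : DirectedOn (· ≤ ·) d) {K : Smyth X}
    (hK : IsLUB d K) (h : K.carrier ⊆ U) : ∃ M ∈ d, M.carrier ⊆ U := by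
  have := (Topology.IsScott.isOpen_iff_isUpperSet_and_dirSupInaccOn (D := univ)).1 (isOpen_box hX hU)
  rw [dirSupInaccOn_univ] at this
  exact this.2 hne hdir hK h

theorem isCompact_biUnion (hX : WellFiltered X) {𝒦 : Set (Smyth X)} (h : IsCompact 𝒦) :
    IsCompact {x | ∃ K ∈ 𝒦, x ∈ K.carrier} := by
  refine isCompact_of_directed fun F hne hdir hF hmeet => ?_
  have : Nonempty F := hne.to_subtype
  obtain ⟨K, hK, hKF⟩ := compact_inter_directed h
    (fun A : F => {K : Smyth X | K.carrier ⊆ (A : Set X)ᶜ}ᶜ)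
    (fun A => (isOpen_box hX (hF A A.2).isOpen_compl).isClosed_compl)
    (fun A B => by
      obtain ⟨C, hC, hCA, hCB⟩ := hdir A A.2 B B.2
      exact ⟨⟨C, hC⟩, compl_subset_compl.2 fun K hK => hK.trans (compl_subset_compl.2 hCA),
        compl_subset_compl.2 fun K hK => hK.trans (compl_subset_compl.2 hCB)⟩)
    (fun A => by
      obtain ⟨x, ⟨K, hK, hx⟩, hxA⟩ := hmeet A A.2
      exact ⟨K, hK, fun hK' => hK' hx hxA⟩)
  obtain ⟨x, hxK, hx⟩ := compact_inter_directed K.isCompact (fun A : F => (A : Set X))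
    (fun A => hF A A.2) (fun A B => by
      obtain ⟨C, hC, hCA, hCB⟩ := hdir A A.2 B B.2
      exact ⟨⟨C, hC⟩, hCA, hCB⟩)
    (fun A => by
      obtain ⟨x, hx, hxA⟩ := not_subset.1 (mem_iInter.1 hKF A)
      exact ⟨x, hx, not_not.1 hxA⟩)
  exact ⟨x, ⟨K, hK, hxK⟩, by rwa [sInter_eq_iInter]⟩

/-- The Smyth power construction of a well-filtered space is well-filtered in its Scott topology. -/
theorem wellFiltered (hX : WellFiltered X) : WellFiltered (Smyth X) := by
  intro 𝒞 𝒰 hne hdir h𝒞 h𝒰 hsub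
  by_contra! hcon
  have hne1 : ∀ 𝒦 ∈ 𝒞, (𝒦 ∩ 𝒰ᶜ).Nonempty := fun K hK => by
    obtain ⟨x, hx, hxU⟩ := not_subset.1 (hcon K hK)
    exact ⟨x, hx, hxU⟩
  obtain ⟨𝒜, h𝒜𝒰, h𝒜, h𝒜𝒞, hmin⟩ :=
    exists_minimal_closed (fun K hK => (h𝒞 K hK).1) h𝒰.isClosed_compl hne1
  have h𝒜2 := Topology.IsScott.isClosed_iff_isLowerSet_and_dirSupClosed.1 h𝒜
  let f : ∀ 𝒦, 𝒦 ∈ 𝒞 → Smyth X := fun 𝒦 h =>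
    { carrier := {x | ∃ K ∈ 𝒦 ∩ 𝒜, x ∈ K.carrier}
      nonempty := by
        obtain ⟨K, hK⟩ := h𝒜𝒞 𝒦 h
        obtain ⟨x, hx⟩ := K.nonempty
        exact ⟨x, K, hK, hx⟩
      isCompact := isCompact_biUnion hX ((h𝒞 𝒦 h).1.inter_right h𝒜)
      isSaturated := isSaturated_iff.2 fun x y hxy ⟨K, hK, hx⟩ => ⟨K, hK, K.isUpperSet hxy hx⟩ }
  let d : Set (Smyth X) := {K | ∃ 𝒦, ∃ h : 𝒦 ∈ 𝒞, K = f 𝒦 h}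
  have hdne : d.Nonempty := by
    obtain ⟨𝒦, h⟩ := hne
    exact ⟨_, 𝒦, h, rfl⟩
  have hddir : DirectedOn (· ≤ ·) d := by
    rintro _ ⟨𝒦, h𝒦, rfl⟩ _ ⟨ℳ, hℳ, rfl⟩
    obtain ⟨𝒩, h𝒩, h1, h2⟩ := hdir 𝒦 h𝒦 ℳ hℳ
    exact ⟨_, ⟨𝒩, h𝒩, rfl⟩, fun x ⟨K, hK, hx⟩ => ⟨K, ⟨h1 hK.1, hK.2⟩, hx⟩,
      fun x ⟨K, hK, hx⟩ => ⟨K, ⟨h2 hK.1, hK.2⟩, hx⟩⟩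
  have hlub := isLUB_inter hX d hdne hddir
  set F := inter hX d hdne hddir with hF
  have hFA : F ∈ 𝒜 := by
    refine h𝒜2.2 ?_ hdne hddir hlub
    rintro _ ⟨𝒦, h𝒦, rfl⟩
    obtain ⟨K, hK⟩ := h𝒜𝒞 𝒦 h𝒦
    exact h𝒜2.1 (fun x hx => ⟨K, hK, hx⟩ : f 𝒦 h𝒦 ≤ K) hK.2
  have hFK : ∀ K ∈ 𝒜, K ≤ F := by
    intro K hK x hx
    have hcl : IsClosed (𝒜 ∩ {M : Smyth X | M.carrier ⊆ (Iic x)ᶜ}ᶜ) :=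
      h𝒜.inter (isOpen_box hX isClosed_Iic.isOpen_compl).isClosed_compl
    have := hmin _ inter_subset_left hcl (fun 𝒦 h𝒦 => by
      obtain ⟨M, hM, hxM⟩ := hx _ ⟨𝒦, h𝒦, rfl⟩
      exact ⟨M, hM.1, hM.2, fun h => h hxM (mem_Iic.2 le_rfl)⟩) hK
    obtain ⟨y, hy, hyx⟩ := not_subset.1 this.2
    exact K.isUpperSet (not_not.1 hyx) hy
  refine h𝒜𝒰 hFA (hsub fun 𝒦 h𝒦 => ?_)
  obtain ⟨K, hK⟩ := h𝒜𝒞 𝒦 h𝒦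
  exact isSaturated_iff.1 (h𝒞 𝒦 h𝒦).2 (hFK K hK.2) hK.1

/-- The functorial action: `K ↦ ↑f(K)`. -/
def map {Y : Type v} [PartialOrder Y] [TopologicalSpace Y] [Topology.IsScott Y univ] (f : X → Y)
    (hf : Continuous f) (K : Smyth X) : Smyth Y where
  carrier := {y | ∃ x ∈ K.carrier, f x ≤ y}
  nonempty := by
    obtain ⟨x, hx⟩ := K.nonempty
    exact ⟨f x, x, hx, le_rfl⟩
  isCompact := by
    refine isCompact_of_directed fun F hne hdir hF hmeet => ?_
    have : Nonempty F := hne.to_subtype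
    obtain ⟨x, hxK, hx⟩ := compact_inter_directed K.isCompact (fun A : F => f ⁻¹' (A : Set Y))
      (fun A => (hF A A.2).preimage hf) (fun A B => by
        obtain ⟨C, hC, hCA, hCB⟩ := hdir A A.2 B B.2
        exact ⟨⟨C, hC⟩, preimage_mono hCA, preimage_mono hCB⟩)
      (fun A => by
        obtain ⟨y, ⟨x, hx, hxy⟩, hyA⟩ := hmeet A A.2
        exact ⟨x, hx, Topology.IsScott.isLowerSet_of_isClosed (hF A A.2) hxy hyA⟩)
    exact ⟨f x, ⟨x, hxK, le_rfl⟩, fun A hA => mem_iInter.1 hx ⟨A, hA⟩⟩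
  isSaturated := isSaturated_iff.2 fun _ _ hyz ⟨x, hx, hxy⟩ => ⟨x, hx, hxy.trans hyz⟩

theorem continuous_map (hX : WellFiltered X) {Y : Type v} [PartialOrder Y] [TopologicalSpace Y]
    [Topology.IsScott Y univ] {f : X → Y} (hf : Continuous f) : Continuous (map f hf) := by
  refine continuous_of_isLUB fun d hne hdir a ha => ⟨?_, fun M hM y hy => ?_⟩
  · rintro _ ⟨K, hK, rfl⟩ y ⟨x, hx, hxy⟩
    exact ⟨x, ha.1 hK hx, hxy⟩
  · by_contra hcon
    obtain ⟨K, hK, h⟩ := exists_subset_of_isLUB hX ((isClosed_Iic (a := y)).isOpen_compl.preimage hf)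
      hne hdir ha (fun x hx hxy => hcon ⟨x, hx, hxy⟩)
    obtain ⟨x, hx, hxy⟩ := hM ⟨K, hK, rfl⟩ hy
    exact h hx hxy

/-- The unit: `x ↦ ↑x`. -/
def up (x : X) : Smyth X where
  carrier := Ici x
  nonempty := ⟨x, le_rfl⟩
  isCompact := isCompact_of_directed fun F _ _ hF hmeet => ⟨x, mem_Ici.2 le_rfl, fun A hA => by
    obtain ⟨y, hxy, hy⟩ := hmeet A hA
    exact Topology.IsScott.isLowerSet_of_isClosed (hF A hA) hxy hy⟩
  isSaturated := isSaturated_iff.2 (isUpperSet_Ici x)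

theorem continuous_up : Continuous (up : X → Smyth X) := by
  refine continuous_of_isLUB fun d hne hdir a ha => ⟨?_, fun M hM y hy => ?_⟩
  · rintro _ ⟨x, hx, rfl⟩
    exact Ici_subset_Ici.2 (ha.1 hx)
  · exact ha.2 fun x hx => hM ⟨x, hx, rfl⟩ hy

/-- The multiplication: `𝒦 ↦ ⋃ 𝒦`. -/
def join (hX : WellFiltered X) (𝒦 : Smyth (Smyth X)) : Smyth X where
  carrier := {x | ∃ K ∈ 𝒦.carrier, x ∈ K.carrier}
  nonempty := by
    obtain ⟨K, hK⟩ := 𝒦.nonempty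
    obtain ⟨x, hx⟩ := K.nonempty
    exact ⟨x, K, hK, hx⟩
  isCompact := isCompact_biUnion hX 𝒦.isCompact
  isSaturated := isSaturated_iff.2 fun _ _ hxy ⟨K, hK, hx⟩ => ⟨K, hK, K.isUpperSet hxy hx⟩

theorem continuous_join (hX : WellFiltered X) : Continuous (join hX) := by
  refine continuous_of_isLUB fun d hne hdir a ha => ⟨?_, fun M hM x hx => ?_⟩
  · rintro _ ⟨𝒦, h𝒦, rfl⟩ x ⟨K, hK, hx⟩
    exact ⟨K, ha.1 h𝒦 hK, hx⟩
  · by_contra hcon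
    obtain ⟨𝒦, h𝒦, h⟩ := exists_subset_of_isLUB (wellFiltered hX)
      (isOpen_box hX (isClosed_Iic (a := x)).isOpen_compl) hne hdir ha
      (fun K hK y hy hyx => hcon ⟨K, hK, K.isUpperSet hyx hy⟩)
    obtain ⟨K, hK, hxK⟩ := hM ⟨𝒦, h𝒦, rfl⟩ hx
    exact h hK hxK (mem_Iic.2 le_rfl)

end Scott

end Smyth

/-! ### The comparison map from `H(Q(L))` to `Q(H(L))` -/

section Phi

variable {X : Type u} [PartialOrder X] [TopologicalSpace X] [Topology.IsScott X univ]

/-- The closed set of all `K` that meet `C`. -/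
def hit (hX : WellFiltered X) (C : Hoare X) : Hoare (Smyth X) :=
  Hoare.mk {K | (C.carrier ∩ K.carrier).Nonempty} (by
    convert (Smyth.isOpen_box hX C.isClosed.isOpen_compl).isClosed_compl using 1
    ext K
    simp [not_subset, Set.Nonempty, and_comm])

theorem isCompact_hitting (K : Smyth X) :
    IsCompact {C : Hoare X | (C.carrier ∩ K.carrier).Nonempty} := by
  convert (Smyth.map Hoare.down Hoare.continuous_down K).isCompact using 1
  ext C
  exact ⟨fun ⟨x, hx, hxK⟩ => ⟨x, hxK, Hoare.down_le_iff.2 hx⟩,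
    fun ⟨x, hxK, hx⟩ => ⟨x, Hoare.down_le_iff.1 hx, hxK⟩⟩

/-- `φ(𝒜) = {C | C ∩ K ≠ ∅ for all K ∈ 𝒜}`. -/
def phi (𝒜 : Hoare (Smyth X)) : Smyth (Hoare X) where
  carrier := {C | ∀ K ∈ 𝒜.carrier, (C.carrier ∩ K.carrier).Nonempty}
  nonempty := by
    refine ⟨Hoare.mk univ isClosed_univ, fun K _ => ?_⟩
    obtain ⟨x, hx⟩ := K.nonempty
    exact ⟨x, mem_univ x, hx⟩
  isCompact := by
    have := isCompact_sInter_of_upper (X := Hoare X) Hoare.isDcpo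
      (𝒞 := (fun K : Smyth X => {C : Hoare X | (C.carrier ∩ K.carrier).Nonempty}) '' 𝒜.carrier) (by
        rintro _ ⟨K, -, rfl⟩
        exact ⟨isCompact_hitting K, fun C D hCD ⟨x, hx, hxK⟩ => ⟨x, hCD hx, hxK⟩⟩)
    convert this using 1
    ext C
    simp
  isSaturated := isSaturated_iff.2 fun C D hCD hC K hK => by
    obtain ⟨x, hx, hxK⟩ := hC K hK
    exact ⟨x, hCD hx, hxK⟩

theorem mem_phi_iff (hX : WellFiltered X) {𝒜 : Hoare (Smyth X)} {C : Hoare X} :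
    C ∈ (phi 𝒜).carrier ↔ 𝒜 ≤ hit hX C := Iff.rfl

theorem continuous_phi (hX : WellFiltered X) :
    Continuous (phi : Hoare (Smyth X) → Smyth (Hoare X)) := by
  refine continuous_of_isLUB fun d hne hdir a ha => ⟨?_, fun M hM C hC => ?_⟩
  · rintro _ ⟨𝒜, h𝒜, rfl⟩ C hC K hK
    exact hC K (ha.1 h𝒜 hK)
  · exact (mem_phi_iff hX).2 (ha.2 fun 𝒜 h𝒜 => (mem_phi_iff hX).1 (hM ⟨𝒜, h𝒜, rfl⟩ hC))

end Phi

/-! ### The monads -/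

/-- The Hoare power construction as an endofunctor of the category of well-filtered dcpos. -/
def hoareFunctor : WF.{u} ⥤ WF.{u} where
  obj L := ⟨Hoare L, Hoare.isDcpo, wellFiltered_of_sup Hoare.isDcpo⟩
  map f := ⟨Hoare.map f.toFun, Hoare.continuous_map f.continuous_toFun⟩
  map_id L := WF.hom_ext fun A => Hoare.eq_of_le_iff fun B => Hoare.map_le_iff
  map_comp {L M N} f g := WF.hom_ext fun A => Hoare.eq_of_le_iff fun B => by
    refine Hoare.map_le_iff.trans (Iff.symm (Hoare.map_le_iff.trans ?_))
    exact Hoare.map_le_iff (A := A) (f := f.toFun)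
      (B := Hoare.mk _ (B.isClosed.preimage g.continuous_toFun))

/-- The Hoare power monad on the category of well-filtered dcpos. -/
def hoareMonad : Monad WF.{u} where
  toFunctor := hoareFunctor
  η :=
    { app := fun L => ⟨Hoare.down, Hoare.continuous_down⟩
      naturality := fun L M f => WF.hom_ext fun x => Hoare.eq_of_le_iff fun B => by
        refine Hoare.down_le_iff.trans (Iff.symm (Hoare.map_le_iff.trans ?_))
        exact Hoare.down_le_iff (A := Hoare.mk _ (B.isClosed.preimage f.continuous_toFun)) }
  μ :=
    { app := fun L => ⟨Hoare.join, Hoare.continuous_join⟩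
      naturality := fun L M f => WF.hom_ext fun 𝒜 => Hoare.eq_of_le_iff fun B => by
        refine Hoare.join_le_iff.trans (Iff.symm (Hoare.map_le_iff.trans ?_))
        refine (Hoare.join_le_iff (𝒜 := 𝒜)
          (B := Hoare.mk _ (B.isClosed.preimage f.continuous_toFun))).trans (Iff.symm ?_)
        refine (Hoare.map_le_iff (B := Hoare.down B)).trans ?_
        exact forall₂_congr fun A _ => Hoare.map_le_iff }
  assoc L := WF.hom_ext fun 𝒜 => Hoare.eq_of_le_iff fun B => by
    refine Hoare.join_le_iff.trans ((Hoare.map_le_iff (B := Hoare.down B)).trans (Iff.symm ?_))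
    refine Hoare.join_le_iff.trans ((Hoare.join_le_iff (B := Hoare.down B)).trans ?_)
    exact forall₂_congr fun A _ => (Hoare.join_le_iff (𝒜 := A)).symm
  left_unit L := WF.hom_ext fun A => Hoare.eq_of_le_iff fun B =>
    Hoare.join_le_iff.trans (Hoare.down_le_iff (A := Hoare.down B))
  right_unit L := WF.hom_ext fun A => Hoare.eq_of_le_iff fun B =>
    Hoare.join_le_iff.trans ((Hoare.map_le_iff (B := Hoare.down B)).trans
      (forall₂_congr fun _ _ => Hoare.down_le_iff))

/-- The Smyth power construction as an endofunctor of the category of well-filtered dcpos. -/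
def smythFunctor : WF.{u} ⥤ WF.{u} where
  obj L := ⟨Smyth L, Smyth.isDcpo L.wellFiltered, Smyth.wellFiltered L.wellFiltered⟩
  map {L M} f := ⟨Smyth.map f.toFun f.continuous_toFun,
    Smyth.continuous_map L.wellFiltered f.continuous_toFun⟩
  map_id L := WF.hom_ext fun K => Smyth.ext (Set.ext fun _ =>
    ⟨fun ⟨_, hx, hxy⟩ => K.isUpperSet hxy hx, fun hy => ⟨_, hy, le_rfl⟩⟩)
  map_comp f g := WF.hom_ext fun K => Smyth.ext (Set.ext fun _ =>
    ⟨fun ⟨x, hx, hxy⟩ => ⟨f.toFun x, ⟨x, hx, le_rfl⟩, hxy⟩,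
      fun ⟨_, ⟨x, hx, hxy⟩, hyz⟩ =>
        ⟨x, hx, (monotone_of_continuous g.continuous_toFun hxy).trans hyz⟩⟩)

/-- The Smyth power monad on the category of well-filtered dcpos. -/
def smythMonad : Monad WF.{u} where
  toFunctor := smythFunctor
  η :=
    { app := fun L => ⟨Smyth.up, Smyth.continuous_up⟩
      naturality := fun L M f => WF.hom_ext fun x => Smyth.ext (Set.ext fun _ =>
        ⟨fun h => ⟨x, le_rfl, h⟩,
          fun ⟨_, hx, hxy⟩ => (monotone_of_continuous f.continuous_toFun hx).trans hxy⟩) }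
  μ :=
    { app := fun L => ⟨Smyth.join L.wellFiltered, Smyth.continuous_join L.wellFiltered⟩
      naturality := fun _ _ f => WF.hom_ext fun _ => Smyth.ext (Set.ext fun _ =>
        ⟨fun ⟨_, ⟨K, hK, hKM⟩, hy⟩ => by
          obtain ⟨x, hx, hxy⟩ := hKM hy
          exact ⟨x, ⟨K, hK, hx⟩, hxy⟩,
        fun ⟨x, ⟨K, hK, hx⟩, hxy⟩ =>
          ⟨Smyth.map f.toFun f.continuous_toFun K, ⟨K, hK, le_rfl⟩, x, hx, hxy⟩⟩) }
  assoc L := WF.hom_ext fun _ => Smyth.ext (Set.ext fun _ =>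
    ⟨fun ⟨_, ⟨K, hK, hKM⟩, hy⟩ => by
      obtain ⟨M, hM, hyM⟩ := hKM hy
      exact ⟨M, ⟨K, hK, hM⟩, hyM⟩,
    fun ⟨M, ⟨K, hK, hM⟩, hyM⟩ =>
      ⟨Smyth.join L.wellFiltered K, ⟨K, hK, le_rfl⟩, M, hM, hyM⟩⟩)
  left_unit L := WF.hom_ext fun K => Smyth.ext (Set.ext fun _ =>
    ⟨fun ⟨_, hKM, hy⟩ => hKM hy, fun hy => ⟨K, le_refl K, hy⟩⟩)
  right_unit L := WF.hom_ext fun K => Smyth.ext (Set.ext fun _ =>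
    ⟨fun ⟨_, ⟨_, hx, hxM⟩, hy⟩ => K.isUpperSet (hxM hy) hx,
      fun hy => ⟨Smyth.up _, ⟨_, hy, le_rfl⟩, le_rfl⟩⟩)

/-! ### Distributive laws and composite monads -/

/-- A distributive law of the monad `S` over the monad `T`: a natural transformation with components
`T (S X) ⟶ S (T X)`, compatible with the units and the multiplications. -/
structure DistributiveLaw {C : Type u} [Category.{v} C] (S T : Monad C) where
  law : S.toFunctor ⋙ T.toFunctor ⟶ T.toFunctor ⋙ S.toFunctor
  map_unit : ∀ X : C, T.map (S.η.app X) ≫ law.app X = S.η.app (T.obj X)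
  unit_obj : ∀ X : C, T.η.app (S.obj X) ≫ law.app X = S.map (T.η.app X)
  map_mul : ∀ X : C, T.map (S.μ.app X) ≫ law.app X =
    law.app (S.obj X) ≫ S.map (law.app X) ≫ S.μ.app (T.obj X)
  mul_obj : ∀ X : C, T.μ.app (S.obj X) ≫ law.app X =
    T.map (law.app X) ≫ law.app (T.obj X) ≫ S.map (T.μ.app X)

/-- The monad `S ∘ T` determined by a distributive law of `S` over `T`. -/
def DistributiveLaw.composite {C : Type u} [Category.{v} C] {S T : Monad C}
    (l : DistributiveLaw S T) : Monad C where
  toFunctor := T.toFunctor ⋙ S.toFunctor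
  η :=
    { app := fun X => T.η.app X ≫ S.η.app (T.obj X)
      naturality := fun X Y f => by
        have h1 := T.η.naturality f
        have h2 := S.η.naturality (T.map f)
        simp only [Functor.id_map, Functor.id_obj, Functor.comp_map, Functor.comp_obj] at *
        rw [reassoc_of% h1, h2, Category.assoc] }
  μ :=
    { app := fun X => S.map (l.law.app (T.obj X)) ≫ S.μ.app (T.obj (T.obj X)) ≫ S.map (T.μ.app X)
      naturality := fun X Y f => by
        have h1 := l.law.naturality (T.map f)
        have h2 := S.μ.naturality (T.map (T.map f))
        have h3 := T.μ.naturality f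
        simp only [Functor.comp_map, Functor.comp_obj] at *
        rw [Category.assoc, Category.assoc, ← S.map_comp, ← h3, S.map_comp, ← reassoc_of% h2,
          ← S.map_comp_assoc, h1, S.map_comp_assoc] }
  assoc X := by
    have a1 := l.law.naturality (T.μ.app X)
    have a2 := l.map_mul (T.obj (T.obj X))
    have a3 := l.law.naturality (l.law.app (T.obj X))
    have a4 := S.μ.naturality (T.map (T.μ.app X))
    have a5 := T.assoc X
    have a6 := S.assoc (T.obj (T.obj (T.obj X)))
    have b1 := l.mul_obj (T.obj X)
    have b2 := S.μ.naturality
      (T.map (l.law.app (T.obj X)) ≫ l.law.app (T.obj (T.obj X)) ≫ S.map (T.μ.app (T.obj X)))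
    have b3 := S.μ.naturality (T.μ.app (T.obj X))
    have b4 := S.μ.naturality (S.map (T.μ.app (T.obj X)))
    simp only [Functor.comp_map, Functor.comp_obj] at *
    have hL : T.map (S.map (l.law.app (T.obj X)) ≫ S.μ.app (T.obj (T.obj X)) ≫ S.map (T.μ.app X)) ≫
        l.law.app (T.obj X) = l.law.app (T.obj (S.obj (T.obj X))) ≫ S.map (T.map (l.law.app (T.obj X))) ≫
          S.map (l.law.app (T.obj (T.obj X))) ≫ S.μ.app (T.obj (T.obj (T.obj X))) ≫
            S.map (T.map (T.μ.app X)) := by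
      rw [T.map_comp, T.map_comp, Category.assoc, Category.assoc, a1, reassoc_of% a2,
        reassoc_of% a3]
    rw [← S.map_comp_assoc, hL]
    simp only [Category.assoc]
    rw [← S.map_comp_assoc (T.μ.app (S.obj (T.obj X))), b1, ← reassoc_of% b2]
    simp only [S.map_comp, Category.assoc]
    rw [reassoc_of% a4, ← S.map_comp, a5, reassoc_of% a6, reassoc_of% b4, reassoc_of% b3,
      S.map_comp]
  left_unit X := by
    have a1 := l.unit_obj (T.obj X)
    have a2 := S.η.naturality (l.law.app (T.obj X))
    have a3 := S.left_unit (T.obj (T.obj X))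
    have a4 := T.left_unit X
    simp only [Functor.comp_obj, Functor.id_map, Functor.id_obj] at *
    rw [Category.assoc, ← reassoc_of% a2, reassoc_of% a1, reassoc_of% a3, ← S.map_comp, a4,
      S.map_id]
  right_unit X := by
    have a1 := l.map_unit (T.obj X)
    have a2 := l.law.naturality (T.η.app X)
    have a3 := S.right_unit (T.obj (T.obj X))
    have a4 := T.right_unit X
    simp only [Functor.comp_map, Functor.comp_obj, Functor.id_obj] at *
    rw [← S.map_comp_assoc, T.map_comp, Category.assoc, a1, S.map_comp_assoc, reassoc_of% a3,
      ← S.map_comp, a4, S.map_id]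

/-- The distributive law `φ` of the Smyth power monad over the Hoare power monad. -/
def phiLaw : DistributiveLaw smythMonad.{u} hoareMonad.{u} where
  law :=
    { app := fun L => ⟨phi, continuous_phi L.wellFiltered⟩
      naturality := fun L M f => WF.hom_ext fun 𝒜 => Smyth.ext (Set.ext fun B => by
        have h1 : B ∈ (phi (Hoare.map (Smyth.map f.toFun f.continuous_toFun) 𝒜)).carrier ↔
            Hoare.mk _ (B.isClosed.preimage f.continuous_toFun) ∈ (phi 𝒜).carrier :=
          (mem_phi_iff M.wellFiltered).trans (Hoare.map_le_iff.trans (forall₂_congr fun K _ =>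
            ⟨fun ⟨y, hy, x, hx, hxy⟩ => ⟨x, B.isLowerSet hxy hy, hx⟩,
              fun ⟨x, hx, hxK⟩ => ⟨f.toFun x, hx, x, hxK, le_rfl⟩⟩))
        refine h1.trans ⟨fun h => ⟨_, h, Hoare.map_le_iff.2 fun _ ha => ha⟩, fun ⟨A, hA, hAB⟩ => ?_⟩
        exact (phi 𝒜).isUpperSet (fun x hx => Hoare.map_le_iff.1 hAB x hx) hA) }
  map_unit L := WF.hom_ext fun A => Smyth.ext (Set.ext fun C => by
    refine (mem_phi_iff L.wellFiltered).trans (Hoare.map_le_iff.trans ?_)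
    exact forall₂_congr fun x _ => ⟨fun ⟨y, hy, hxy⟩ => C.isLowerSet hxy hy,
      fun hx => ⟨x, hx, le_rfl⟩⟩)
  unit_obj L := WF.hom_ext fun K => Smyth.ext (Set.ext fun C => by
    refine (mem_phi_iff L.wellFiltered).trans (Hoare.down_le_iff.trans ?_)
    exact ⟨fun ⟨x, hx, hxK⟩ => ⟨x, hxK, Hoare.down_le_iff.2 hx⟩,
      fun ⟨x, hxK, hx⟩ => ⟨x, Hoare.down_le_iff.1 hx, hxK⟩⟩)
  map_mul L := WF.hom_ext fun 𝒜 => Smyth.ext (Set.ext fun C => by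
    refine (mem_phi_iff L.wellFiltered).trans (Hoare.map_le_iff.trans ?_)
    constructor
    · intro h
      refine ⟨phi (hit L.wellFiltered C), ⟨hit L.wellFiltered C, fun 𝒦 h𝒦 => ?_, le_rfl⟩,
        fun K hK => hK⟩
      obtain ⟨x, hx, K, hK, hxK⟩ := h 𝒦 h𝒦
      exact ⟨K, ⟨x, hx, hxK⟩, hK⟩
    · rintro ⟨ℳ, ⟨ℬ, hℬ, hℳ⟩, hC⟩ 𝒦 h𝒦
      obtain ⟨K, hKℬ, hK⟩ := hℬ 𝒦 h𝒦
      obtain ⟨x, hx, hxK⟩ := hℳ hC K hKℬ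
      exact ⟨x, hx, K, hK, hxK⟩)
  mul_obj L := WF.hom_ext fun 𝒜 => Smyth.ext (Set.ext fun C => by
    refine (mem_phi_iff L.wellFiltered).trans (Hoare.join_le_iff.trans ?_)
    constructor
    · intro h
      refine ⟨Hoare.down C, ?_, Hoare.join_le_iff.2 fun A hA => hA⟩
      have hw : WellFiltered (Hoare L) := (hoareFunctor.obj L).wellFiltered
      have key : Hoare.map (phi : Hoare (Smyth L) → Smyth (Hoare L)) 𝒜 ≤ hit hw (Hoare.down C) :=
        Hoare.map_le_iff.2 fun ℬ hℬ => ⟨C, le_refl C, h ℬ hℬ⟩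
      exact key
    · rintro ⟨𝒞, h𝒞, hC⟩ ℬ hℬ
      obtain ⟨D, hD, hDℬ⟩ := h𝒞 (phi ℬ) (subset_closure ⟨ℬ, hℬ, rfl⟩)
      exact (phi ℬ).isUpperSet (Hoare.join_le_iff.1 hC D hD) hDℬ)

/-- The double power monad `QH`, with unit `θ_H ∘ η` and multiplication `Qμ ∘ ι_HH ∘ Qφ_H`. -/
def doublePowerMonad : Monad WF.{u} := phiLaw.composite

/-! ### Structure maps -/

/-- `a : T X ⟶ X` is a structure map of `X`, that is, `(X, a)` is an Eilenberg-Moore algebra. -/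
structure IsStructureMap {C : Type u} [Category.{v} C] (T : Monad C) {X : C} (a : T.obj X ⟶ X) :
    Prop where
  unit : T.η.app X ≫ a = 𝟙 X
  assoc : T.μ.app X ≫ a = T.map a ≫ a

/-- The Eilenberg-Moore algebra given by a structure map. -/
def IsStructureMap.algebra {C : Type u} [Category.{v} C] {T : Monad C} {X : C} {a : T.obj X ⟶ X}
    (h : IsStructureMap T a) : T.Algebra :=
  ⟨X, a, h.unit, h.assoc⟩

end PowerWF

namespace PowerWF

/-! ### Algebras of the monad composed from an arbitrary distributive law -/

section Composite

variable {C : Type u} [Category.{v} C] {S T : Monad C} (l : DistributiveLaw S T) {X : C}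
  {a : S.obj (T.obj X) ⟶ X}

namespace IsStructureMap

variable {l}

/-! The first two claims are formal and hold for any distributive law of a monad `S` over a monad
`T` in any category. Restricting a structure map `a : S (T X) ⟶ X` along the two units gives an
outer part `S.map (T.η.app X) ≫ a` and an inner part `S.η.app (T.obj X) ≫ a`. Everything follows
from the associativity law of `a` by feeding a unit into it. Inserting the unit of `T` under `S`
collapses the distributive law through `unit_obj` and shows that `a` is an `S`-homomorphism out of
the free algebra (`composite_outer_hom`). Inserting the unit of `S` in front removes one outer layer
and expresses how the inner part interacts with the law (`composite_inner_assoc`). The algebra laws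
of the two parts, and the fact that `l.law.app X ≫ a` is a `T`-homomorphism, are then consequences
of naturality, `map_unit` and `mul_obj`.

Uniqueness combines a formal fact with an order-theoretic one. Formally, `a` is recovered from its
parts: apply `S` to the inner part, then the outer part (`composite_eq`). For the power monads, each
part is forced by the order of `L`: an `H`-structure map must send a closed set to its supremum, and
a `Q`-structure map must send a compact saturated set to its infimum. Hence a `QH`-structure map can
only send a compact saturated family of closed sets to the infimum of their suprema. -/

theorem composite_unit (h : IsStructureMap l.composite (X := X) a) :
    T.η.app X ≫ S.η.app (T.obj X) ≫ a = 𝟙 X :=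
  (Category.assoc _ _ _).symm.trans h.unit

theorem composite_assoc (h : IsStructureMap l.composite (X := X) a) :
    S.map (l.law.app (T.obj X)) ≫ S.μ.app (T.obj (T.obj X)) ≫ S.map (T.μ.app X) ≫ a =
      S.map (T.map a) ≫ a := by
  -- The multiplication and functor of `l.composite` are unfolded by definitional equality, so that
  -- later rewriting sees the separate factors.
  have key : (S.map (l.law.app (T.obj X)) ≫ S.μ.app (T.obj (T.obj X)) ≫ S.map (T.μ.app X)) ≫ a =
      S.map (T.map a) ≫ a := h.assoc
  simpa only [Category.assoc] using key

/-- A structure map of the composite monad is a homomorphism of algebras of the outer monad. -/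
theorem composite_outer_hom (h : IsStructureMap l.composite (X := X) a) :
    S.map a ≫ S.map (T.η.app X) ≫ a = S.μ.app (T.obj X) ≫ a := by
  have u : T.η.app (S.obj (T.obj X)) ≫ l.law.app (T.obj X) = S.map (T.η.app (T.obj X)) :=
    l.unit_obj (T.obj X)
  have t : T.η.app (T.obj X) ≫ T.μ.app X = 𝟙 (T.obj X) := T.left_unit X
  have n1 : a ≫ T.η.app X = T.η.app (S.obj (T.obj X)) ≫ T.map a :=
    T.η.naturality a
  have n2 : S.map (S.map (T.η.app (T.obj X))) ≫ S.μ.app (T.obj (T.obj X)) =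
      S.μ.app (T.obj X) ≫ S.map (T.η.app (T.obj X)) :=
    S.μ.naturality (T.η.app (T.obj X))
  calc S.map a ≫ S.map (T.η.app X) ≫ a
      = S.map (T.η.app (S.obj (T.obj X))) ≫ S.map (T.map a) ≫ a := by
        -- Naturality of `T.η` turns `a` into `T.map a`, which is the form that the associativity
        -- law can consume.
        rw [← S.map_comp_assoc, n1, S.map_comp_assoc]
    _ = S.map (S.map (T.η.app (T.obj X))) ≫ S.μ.app (T.obj (T.obj X)) ≫
          S.map (T.μ.app X) ≫ a := by
        -- By `unit_obj`, a unit of `T` placed before the distributive law leaves only that unit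
        -- under `S`.
        rw [← h.composite_assoc, ← S.map_comp_assoc, u]
    _ = S.μ.app (T.obj X) ≫ a := by
        -- The unit of `T` slides past `S.μ` and cancels against `T.μ`.
        rw [reassoc_of% n2, ← S.map_comp_assoc, t, S.map_id, Category.id_comp]

/-- The inner structure map absorbs the distributive law. -/
theorem composite_inner_assoc (h : IsStructureMap l.composite (X := X) a) :
    T.map a ≫ S.η.app (T.obj X) ≫ a = l.law.app (T.obj X) ≫ S.map (T.μ.app X) ≫ a := by
  have n1 : T.map a ≫ S.η.app (T.obj X) = S.η.app (T.obj (S.obj (T.obj X))) ≫ S.map (T.map a) :=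
    S.η.naturality (T.map a)
  have n2 : l.law.app (T.obj X) ≫ S.η.app (S.obj (T.obj (T.obj X))) =
      S.η.app (T.obj (S.obj (T.obj X))) ≫ S.map (l.law.app (T.obj X)) :=
    S.η.naturality (l.law.app (T.obj X))
  have t : S.η.app (S.obj (T.obj (T.obj X))) ≫ S.μ.app (T.obj (T.obj X)) =
      𝟙 (S.obj (T.obj (T.obj X))) := S.left_unit (T.obj (T.obj X))
  -- Associativity is precomposed with the unit of `S`: naturality carries this unit past the
  -- distributive law, where it cancels against `S.μ`.
  rw [reassoc_of% n1, ← h.composite_assoc, ← reassoc_of% n2, reassoc_of% t]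

/-- The axiom `mul_obj` rewrites the right side so that it ends in exactly the expression produced
by `composite_inner_assoc`. -/
theorem composite_inner_hom (h : IsStructureMap l.composite (X := X) a) :
    T.map (l.law.app X ≫ a) ≫ S.η.app (T.obj X) ≫ a =
      T.μ.app (S.obj X) ≫ l.law.app X ≫ a := by
  have m : T.μ.app (S.obj X) ≫ l.law.app X =
      T.map (l.law.app X) ≫ l.law.app (T.obj X) ≫ S.map (T.μ.app X) := l.mul_obj X
  rw [reassoc_of% m, ← h.composite_inner_assoc]
  exact T.map_comp_assoc (l.law.app X) a _

/-- A structure map of the composite monad restricts to one of the outer monad. -/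
theorem composite_outer (h : IsStructureMap l.composite (X := X) a) :
    IsStructureMap S (S.map (T.η.app X) ≫ a) where
  unit := by
    have n : T.η.app X ≫ S.η.app (T.obj X) = S.η.app X ≫ S.map (T.η.app X) :=
      S.η.naturality (T.η.app X)
    exact ((reassoc_of% n) a).symm.trans h.composite_unit
  assoc := by
    have n : S.map (S.map (T.η.app X)) ≫ S.μ.app (T.obj X) = S.μ.app X ≫ S.map (T.η.app X) :=
      S.μ.naturality (T.η.app X)
    -- Once the unit of `T` has moved past `S.μ`, the homomorphism property of `a` supplies the
    -- associativity.
    exact ((reassoc_of% n) a).symm.trans (by rw [← h.composite_outer_hom, S.map_comp_assoc])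

/-- A structure map of the composite monad restricts to one of the inner monad. -/
theorem composite_inner (h : IsStructureMap l.composite (X := X) a) :
    IsStructureMap T (S.η.app (T.obj X) ≫ a) where
  unit := h.composite_unit
  assoc := by
    have n : T.μ.app X ≫ S.η.app (T.obj X) = S.η.app (T.obj (T.obj X)) ≫ S.map (T.μ.app X) :=
      S.η.naturality (T.μ.app X)
    have m : T.map (S.η.app (T.obj X)) ≫ l.law.app (T.obj X) = S.η.app (T.obj (T.obj X)) :=
      l.map_unit (T.obj X)
    refine ((reassoc_of% n) a).trans ?_
    -- The axiom `map_unit` is read backwards: it introduces the distributive law that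
    -- `composite_inner_assoc` then absorbs.
    rw [← reassoc_of% m, ← h.composite_inner_assoc]
    exact (T.map_comp_assoc (S.η.app (T.obj X)) a _).symm

/-- A structure map of the composite monad is determined by its restrictions. -/
theorem composite_eq (h : IsStructureMap l.composite (X := X) a) :
    S.map (S.η.app (T.obj X) ≫ a) ≫ S.map (T.η.app X) ≫ a = a := by
  have t : S.map (S.η.app (T.obj X)) ≫ S.μ.app (T.obj X) = 𝟙 (S.obj (T.obj X)) :=
    S.right_unit (T.obj X)
  refine (S.map_comp_assoc (S.η.app (T.obj X)) a _).trans ?_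
  -- The homomorphism property creates an `S.μ`, which cancels against `S.map` of the unit of `S`.
  rw [h.composite_outer_hom, reassoc_of% t]

end IsStructureMap

end Composite

/-! ### Structure maps of the two power monads as suprema and infima -/

/-- A structure map of the Hoare power monad sends a closed set to its supremum. -/
theorem IsStructureMap.isLUB_hoare {L : WF.{u}} {a : hoareMonad.obj L ⟶ L}
    (h : IsStructureMap hoareMonad a) (A : Hoare L) : IsLUB A.carrier (a.toFun A) := by
  have hmono {K M : Hoare L} (hKM : K ≤ M) : a.toFun K ≤ a.toFun M :=
    monotone_of_continuous (X := hoareMonad.obj L) a.continuous_toFun hKM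
  have hunit (x : L) : a.toFun (Hoare.down x) = x := congrFun (congrArg WF.Hom.toFun h.unit) x
  -- Monotonicity and the unit law suffice: `x ∈ A` means `↓x ≤ A`, and `b` bounds `A` from above
  -- exactly when `A ≤ ↓b`.
  refine ⟨fun x hx => ?_, fun b hb => ?_⟩
  · exact (hunit x).ge.trans (hmono (Hoare.down_le_iff.2 hx))
  · exact (hmono (show A ≤ Hoare.down b from fun x hx => hb hx)).trans (hunit b).le

/-- A structure map of the Smyth power monad sends a compact saturated set to its infimum. -/
theorem IsStructureMap.isGLB_smyth {L : WF.{u}} {a : smythMonad.obj L ⟶ L}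
    (h : IsStructureMap smythMonad a) (K : Smyth L) : IsGLB K.carrier (a.toFun K) := by
  have hmono {K M : Smyth L} (hKM : K ≤ M) : a.toFun K ≤ a.toFun M :=
    monotone_of_continuous (X := smythMonad.obj L) a.continuous_toFun hKM
  have hunit (x : L) : a.toFun (Smyth.up x) = x := congrFun (congrArg WF.Hom.toFun h.unit) x
  -- The order is reverse inclusion, so `x ∈ K` means `K ≤ ↑x`, and a lower bound `b` of `K`
  -- satisfies `↑b ≤ K`; this is why an infimum appears.
  refine ⟨fun x hx => ?_, fun b hb => ?_⟩
  · exact (hmono (show K ≤ Smyth.up x from fun y hy => K.isUpperSet hy hx)).trans (hunit x).le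
  · exact (hunit b).ge.trans (hmono (show Smyth.up b ≤ K from fun x hx => hb hx))

theorem IsStructureMap.hoare_unique {L : WF.{u}} {a b : hoareMonad.obj L ⟶ L}
    (ha : IsStructureMap hoareMonad a) (hb : IsStructureMap hoareMonad b) : a = b :=
  WF.hom_ext fun A => (ha.isLUB_hoare A).unique (hb.isLUB_hoare A)

theorem IsStructureMap.smyth_unique {L : WF.{u}} {a b : smythMonad.obj L ⟶ L}
    (ha : IsStructureMap smythMonad a) (hb : IsStructureMap smythMonad b) : a = b :=
  WF.hom_ext fun K => (ha.isGLB_smyth K).unique (hb.isGLB_smyth K)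

end PowerWF

/-! ### The proposition for the double power monad -/

theorem mainTheorem8 (L : PowerWF.WF.{u}) (α : PowerWF.doublePowerMonad.obj L ⟶ L)
    (hα : PowerWF.IsStructureMap PowerWF.doublePowerMonad α) :
    -- (1) `α ∘ Qη_L` is a `Q`-structure map and `α ∘ θ_{H(L)}` is an `H`-structure map of `L`
    ∃ (hQ : PowerWF.IsStructureMap PowerWF.smythMonad
        (PowerWF.smythMonad.map (PowerWF.hoareMonad.η.app L) ≫ α))
      (hH : PowerWF.IsStructureMap PowerWF.hoareMonad
        (PowerWF.smythMonad.η.app (PowerWF.hoareMonad.obj L) ≫ α)),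
      -- (2) `α : (QH(L), ι_{H(L)}) ⟶ (L, α ∘ Qη_L)` is a `Q`-algebra homomorphism
      (∃ f : PowerWF.smythMonad.free.obj (PowerWF.hoareMonad.obj L) ⟶ hQ.algebra, f.f = α) ∧
      -- and `α ∘ φ_L : (HQ(L), μ_{Q(L)}) ⟶ (L, α ∘ θ_{H(L)})` is an `H`-algebra homomorphism
      (∃ g : PowerWF.hoareMonad.free.obj (PowerWF.smythMonad.obj L) ⟶ hH.algebra,
        g.f = PowerWF.phiLaw.law.app L ≫ α) ∧
      -- (3) `α` is the unique `QH`-structure map of `L`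
      ∀ β : PowerWF.doublePowerMonad.obj L ⟶ L,
        PowerWF.IsStructureMap PowerWF.doublePowerMonad β → β = α := by
  -- Unfolding the double power monad to `phiLaw.composite` exposes the distributive law to the
  -- general lemmas.
  have hα' : PowerWF.IsStructureMap PowerWF.phiLaw.composite α := hα
  refine ⟨hα'.composite_outer, hα'.composite_inner, ⟨⟨α, hα'.composite_outer_hom⟩, rfl⟩,
    ⟨⟨PowerWF.phiLaw.law.app L ≫ α, hα'.composite_inner_hom⟩, rfl⟩, fun β hβ => ?_⟩
  have hβ' : PowerWF.IsStructureMap PowerWF.phiLaw.composite β := hβ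
  -- Both maps are expanded into their inner and outer parts, and these agree by uniqueness for each
  -- power monad.
  rw [← hβ'.composite_eq, ← hα'.composite_eq, hβ'.composite_inner.hoare_unique hα'.composite_inner,
    hβ'.composite_outer.smyth_unique hα'.composite_outer]
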